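/- Let $V$ be a finite-dimensional complex vector space carrying two Lie brackets, and let $\mathfrak{g}=(V,[\,,])$ and $\mathfrak{n}=(V,\{\,,\})$ be the resulting Lie algebras. A post-Lie algebra structure on the pair $(\mathfrak{g},\mathfrak{n})$ is a $\mathbb{C}$-bilinear product $x\cdot y$ on $V$ satisfying, for all $x,y,z\in V$, $$x\cdot y-y\cdot x=[x,y]-\{x,y\},$$ $$[x,y]\cdot z=x\cdot(y\cdot z)-y\cdot(x\cdot z),$$ $$x\cdot\{y,z\}=\{x\cdot y,z\}+\{y,x\cdot z\}.$$ Theorem 5.1. If $\mathfrak{g}$ is reductive (that is, its solvable radical equals its center) with $1$-dimensional center, and $\mathfrak{n}$ is solvable but not nilpotent, then there is no post-Lie algebra structure on $(\mathfrak{g},\mathfrak{n})$. -/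

import Mathlib

/-- A Lie bracket on a `K`-vector space `V`: a `K`-bilinear, alternating map satisfying the
Jacobi identity.  (Mathlib's `LieRing` carries its own additive group, so two Lie brackets on one
and the same vector space are recorded in this unbundled form.) -/
structure LieBracket (K V : Type*) [Field K] [AddCommGroup V] [Module K V] where
  /-- The underlying bilinear map. -/
  toFun : V →ₗ[K] V →ₗ[K] V
  /-- The bracket is alternating. -/
  self_eq_zero : ∀ x : V, toFun x x = 0
  /-- The Jacobi identity, in Leibniz form. -/
  leibniz : ∀ x y z : V, toFun x (toFun y z) = toFun (toFun x y) z + toFun y (toFun x z)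

namespace LieBracket

variable {K V : Type*} [Field K] [AddCommGroup V] [Module K V]

/-- The Lie algebra `(V, b)`: a copy of the vector space `V` whose Lie bracket is `b`. -/
def Alg (_b : LieBracket K V) : Type _ := V

instance (b : LieBracket K V) : AddCommGroup b.Alg := inferInstanceAs (AddCommGroup V)

instance (b : LieBracket K V) : LieRing b.Alg where
  bracket x y := b.toFun x y
  add_lie x y z := b.toFun.map_add₂ x y z
  lie_add x y z := (b.toFun x).map_add y z
  lie_self x := b.self_eq_zero x
  leibniz_lie x y z := b.leibniz x y z

instance (b : LieBracket K V) : LieAlgebra K b.Alg where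
  toModule := inferInstanceAs (Module K V)
  lie_smul t x y := (b.toFun x).map_smul t y

end LieBracket

/-- A post-Lie algebra structure on the pair `(𝔤, 𝔫)`, where `𝔤 = (V, [ , ])` and
`𝔫 = (V, { , })` are two Lie brackets on the same vector space `V`: a `K`-bilinear product
`x · y = mul x y` on `V` such that
* `x · y - y · x = [x, y] - {x, y}`,
* `[x, y] · z = x · (y · z) - y · (x · z)`,
* `x · {y, z} = {x · y, z} + {y, x · z}`. -/
structure PostLieStructure {K V : Type*} [Field K] [AddCommGroup V] [Module K V]
    (g n : LieBracket K V) where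
  /-- The bilinear product. -/
  mul : V →ₗ[K] V →ₗ[K] V
  mul_sub_mul : ∀ x y : V, mul x y - mul y x = g.toFun x y - n.toFun x y
  bracket_mul : ∀ x y z : V, mul (g.toFun x y) z = mul x (mul y z) - mul y (mul x z)
  mul_bracket : ∀ x y z : V,
    mul x (n.toFun y z) = n.toFun (mul x y) z + n.toFun y (mul x z)

/-! Left multiplication makes `𝔤` act on `𝔫` by derivations, and the axiom on `x · y - y · x` says
that the identity of `V` is a bijective crossed homomorphism `c : 𝔤 → 𝔫`. It suffices to exclude
such maps.

By Lie's theorem, the ad-nilpotent elements of the solvable algebra `𝔫` form a subspace `W`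
containing all brackets and all values of derivations, so `c [𝔤, 𝔤] ⊆ W`. It is proper since `𝔫` is
not nilpotent. As `[𝔤, 𝔤]` has codimension at most one, `c [𝔤, 𝔤] = W` and `[𝔤, 𝔤]` meets the center
trivially. Thus `c` restricts to a bijective crossed homomorphism from a semisimple algebra to the
nilpotent algebra `W`.

This is impossible (`not_bijective_of_isCrossedHom`). Take an `sl₂`-triple `e, f, h`. If its values
lie in one term of the lower central series, then modulo the next term they form a cocycle, hence
the coboundary of some `b` (Whitehead, `Relations.exists_eq_coboundary`), and moving `c` by `exp (ad
b)` pushes the values one term down. All actions are traceless, so the determinant of `c` is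
preserved (`det_toMatrix_flow`). Eventually `c e = 0` with `c` invertible, a contradiction. -/

section SolvableAction

/-! ### Nilpotent elements and derivations of solvable Lie algebras. -/

open LieModule LieAlgebra

/-- An extension of a solvable Lie algebra by a solvable Lie algebra is solvable. -/
lemma LieHom.isSolvable_of_isSolvable_ker {R L L' : Type*} [CommRing R] [LieRing L]
    [LieAlgebra R L] [LieRing L'] [LieAlgebra R L'] (f : L →ₗ⁅R⁆ L') [IsSolvable f.ker]
    [IsSolvable L'] : IsSolvable L := by
  obtain ⟨k, hk⟩ := IsSolvable.solvable R L'
  obtain ⟨l, hl⟩ := IsSolvable.solvable R f.ker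
  have h1 : derivedSeries R L k ≤ f.ker := by
    rw [← LieIdeal.map_eq_bot_iff, ← le_bot_iff, ← hk]
    exact LieIdeal.derivedSeries_map_le k
  refine IsSolvable.mk (R := R) (k := l + k) ?_
  rw [derivedSeries_def, derivedSeriesOfIdeal_add, ← le_bot_iff,
    ← (LieIdeal.derivedSeries_eq_bot_iff f.ker l).mp hl]
  exact derivedSeriesOfIdeal_mono h1 l

variable {K H : Type*} [Field K] [CharZero K] [IsAlgClosed K] [LieRing H] [LieAlgebra K H]

/-- The elements of a solvable Lie algebra acting nilpotently on a finite-dimensional module form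
a subspace containing all brackets. -/
theorem LieModule.exists_submodule_mem_iff_isNilpotent_toEnd [IsSolvable H] (M : Type*)
    [AddCommGroup M] [Module K M] [LieRingModule H M] [LieModule K H M] [FiniteDimensional K M] :
    ∃ S : Submodule K H, (∀ x : H, x ∈ S ↔ _root_.IsNilpotent (toEnd K H M x)) ∧ ∀ x y : H, ⁅x, y⁆ ∈ S := by
  induction hd : Module.finrank K M using Nat.strong_induction_on generalizing M with
  | _ d ih =>
  rcases subsingleton_or_nontrivial M with hM | hM
  · exact ⟨⊤, fun x ↦ ⟨fun _ ↦ ⟨0, Subsingleton.elim _ _⟩, fun _ ↦ trivial⟩, fun _ _ ↦ trivial⟩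
  obtain ⟨χ, hχ⟩ := exists_nontrivial_weightSpace_of_isSolvable K H M
  obtain ⟨⟨v, hv⟩, hv0⟩ := exists_ne (0 : weightSpace M χ)
  rw [mem_weightSpace] at hv
  replace hv0 : v ≠ 0 := by simpa using hv0
  let N : LieSubmodule K H M :=
    { K ∙ v with
      lie_mem := by
        intro x m hm
        obtain ⟨t, rfl⟩ := Submodule.mem_span_singleton.mp hm
        rw [lie_smul, hv]
        exact Submodule.smul_mem _ _ (Submodule.smul_mem _ _ (Submodule.mem_span_singleton_self v)) }
  have hN (m : M) (hm : m ∈ N) (x : H) : ⁅x, m⁆ = χ x • m := by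
    obtain ⟨t, rfl⟩ := Submodule.mem_span_singleton.mp hm
    rw [lie_smul, hv, smul_comm]
  have hvN : v ∈ N := Submodule.mem_span_singleton_self v
  have hlt : Module.finrank K (M ⧸ N) < d := by
    rw [← hd]
    have h1 := Submodule.finrank_quotient_add_finrank N.toSubmodule
    have h2 : 0 < Module.finrank K N.toSubmodule :=
      Module.finrank_pos_iff.mpr ⟨⟨⟨v, hvN⟩, 0, by simpa using hv0⟩⟩
    have h3 : Module.finrank K (M ⧸ N) = Module.finrank K (M ⧸ N.toSubmodule) := rfl
    omega
  obtain ⟨S, hS, hSb⟩ := ih _ hlt (M ⧸ N) rfl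
  have hmk (x : H) (k : ℕ) (m : M) : (toEnd K H (M ⧸ N) x ^ k) (LieSubmodule.Quotient.mk m) =
      LieSubmodule.Quotient.mk ((toEnd K H M x ^ k) m) := by
    induction k with
    | zero => rfl
    | succ k ihk => rw [pow_succ', pow_succ', Module.End.mul_apply, ihk]; rfl
  -- `N` is a line on which `x` acts by `χ x`, so `x` is nilpotent on `M` iff `χ x = 0` and `x` is
  -- nilpotent on `M ⧸ N`.
  refine ⟨LinearMap.ker χ ⊓ S, fun x ↦ ⟨?_, ?_⟩, fun x y ↦ ⟨?_, hSb x y⟩⟩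
  · rintro ⟨hx, hxS⟩
    obtain ⟨k, hk⟩ := (hS x).mp hxS
    refine ⟨k + 1, LinearMap.ext fun m ↦ ?_⟩
    have hmem : (toEnd K H M x ^ k) m ∈ N := by
      rw [← LieSubmodule.Quotient.mk_eq_zero]
      exact (hmk x k m).symm.trans (by rw [hk]; rfl)
    rw [pow_succ', Module.End.mul_apply, toEnd_apply_apply, hN _ hmem, LinearMap.mem_ker.mp hx,
      zero_smul]
    rfl
  · rintro ⟨k, hk⟩
    refine ⟨?_, (hS x).mpr ⟨k, LinearMap.ext fun q ↦ ?_⟩⟩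
    · have : (toEnd K H M x).HasEigenvalue (χ x) := Module.End.hasEigenvalue_of_hasEigenvector
        ⟨Module.End.mem_eigenspace_iff.mpr (hv x), hv0⟩
      exact (this.isNilpotent_of_isNilpotent ⟨k, hk⟩).eq_zero
    · obtain ⟨m, rfl⟩ := LieSubmodule.Quotient.surjective_mk' N q
      change (toEnd K H (M ⧸ N) x ^ k) (LieSubmodule.Quotient.mk m) = 0
      rw [hmk, hk]
      rfl
  · have h1 : χ ⁅x, y⁆ • v = 0 := by
      rw [← hv, lie_lie, hv, hv, lie_smul, lie_smul, hv, hv, smul_smul, smul_smul, mul_comm,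
        sub_self]
    exact (smul_eq_zero.mp h1).resolve_right hv0

attribute [local instance 100] LieRing.ofAssociativeRing

/-- A derivation of a solvable Lie algebra takes values in the ad-nilpotent elements. -/
theorem LieDerivation.isNilpotent_ad_apply [FiniteDimensional K H] [IsSolvable H]
    (D : LieDerivation K H H) (v : H) :
    _root_.IsNilpotent (LieAlgebra.ad K H (D v)) := by
  let ψ : K →ₗ⁅K⁆ LieDerivation K H H :=
    { LinearMap.toSpanSingleton K _ D with
      map_lie' := by
        intro s t
        simp [Ring.lie_def, mul_comm] }
  -- Adjoining `D` keeps the algebra solvable and turns `D v` into the bracket of `D` with `v`,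
  -- which acts nilpotently on `G`.
  let G := H ⋊⁅ψ⁆ K
  have : FiniteDimensional K G := (SemiDirectSum.toProdl ψ).symm.finiteDimensional
  have : IsSolvable K := by
    have : IsLieAbelian K := ⟨fun x y ↦ by rw [Ring.lie_def, mul_comm, sub_self]⟩
    exact LieAlgebra.ofAbelianIsSolvable K
  let p : G →ₗ⁅K⁆ K := SemiDirectSum.projr ψ
  have : IsSolvable p.ker := by
    let q : p.ker →ₗ⁅K⁆ H :=
      { toFun := fun x ↦ x.1.left
        map_add' := fun _ _ ↦ rfl
        map_smul' := fun _ _ ↦ rfl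
        map_lie' := by
          rintro ⟨x, hx⟩ ⟨y, hy⟩
          have hx' : x.right = 0 := hx
          have hy' : y.right = 0 := hy
          change ⁅x.left, y.left⁆ + ψ x.right y.left - ψ y.right x.left = ⁅x.left, y.left⁆
          simp [hx', hy'] }
    refine Function.Injective.lieAlgebra_isSolvable (f := q) ?_
    rintro ⟨x, hx⟩ ⟨y, hy⟩ hxy
    have hx' : x.right = 0 := hx
    have hy' : y.right = 0 := hy
    exact Subtype.ext (SemiDirectSum.ext hxy (hx'.trans hy'.symm))
  have : IsSolvable G := p.isSolvable_of_isSolvable_ker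
  obtain ⟨S, hS, hSb⟩ := exists_submodule_mem_iff_isNilpotent_toEnd (K := K) (H := G) G
  obtain ⟨k, hk⟩ := (hS _).mp (hSb (SemiDirectSum.inr ψ 1) (SemiDirectSum.inl ψ v))
  have hb : ⁅SemiDirectSum.inr ψ 1, SemiDirectSum.inl ψ v⁆ = SemiDirectSum.inl ψ (D v) := by
    simp only [SemiDirectSum.inr_eq_mk, SemiDirectSum.inl_eq_mk, SemiDirectSum.lie_eq_mk]
    have : ψ 1 = D := one_smul K D
    simp [this]
  rw [hb] at hk
  have hpow (j : ℕ) (w : H) : (toEnd K G G (SemiDirectSum.inl ψ (D v)) ^ j)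
      (SemiDirectSum.inl ψ w) = SemiDirectSum.inl ψ ((LieAlgebra.ad K H (D v) ^ j) w) := by
    induction j with
    | zero => rfl
    | succ j ih =>
      rw [pow_succ', pow_succ', Module.End.mul_apply, Module.End.mul_apply, ih, toEnd_apply_apply,
        ← LieHom.map_lie, LieAlgebra.ad_apply]
  refine ⟨k, LinearMap.ext fun w ↦ SemiDirectSum.inl_injective ψ ?_⟩
  rw [← hpow, hk]
  rfl

end SolvableAction

/-! ### The Casimir operator and Whitehead's first lemma for `sl₂`. -/

namespace SlTwoOperators

variable {K M : Type*} [Field K] [AddCommGroup M] [Module K M]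
variable {E F H : Module.End K M}

/-- The Casimir operator of a triple of operators satisfying the `sl₂` relations. -/
def casimir (E F H : Module.End K M) : Module.End K M :=
  E * F + F * E + (2⁻¹ : K) • (H * H)

attribute [local instance 100] LieRing.ofAssociativeRing

/-- The nonzero vectors among the `E ^ k m` have distinct weights, so by finite dimension the
sequence stops, and its last nonzero term is a highest weight vector. -/
lemma eigenvalue_add_two_mul_mem [CharZero K] [FiniteDimensional K M]
    (t : IsSl2Triple H E F) {μ : K} {m : M} (hm : m ≠ 0) (hμ : H m = μ • m) :
    ∃ (k n : ℕ) (p : M), p ≠ 0 ∧ H p = (n : K) • p ∧ E p = 0 ∧ μ + 2 * k = n := by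
  have hpow (k : ℕ) : H ((E ^ k) m) = (μ + 2 * k) • (E ^ k) m := by
    simpa using t.lie_h_pow_toEnd_e (R := K) (M := M) (m := m) (μ := μ) (by simpa using hμ) k
  have hex : ∃ k, (E ^ k) m = 0 := by
    by_contra! contra
    have hinj : Function.Injective fun k : ℕ ↦ μ + 2 * (k : K) := fun a b hab ↦ by
      simpa using hab
    have := (Module.End.eigenvectors_linearIndependent' H (fun k : ℕ ↦ μ + 2 * (k : K)) hinj
      (fun k ↦ (E ^ k) m) fun k ↦
        ⟨Module.End.mem_eigenspace_iff.mpr (hpow k), contra k⟩).finite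
    exact Infinite.not_finite this
  obtain ⟨k, hk, hk'⟩ := Nat.exists_not_and_succ_of_not_zero_of_exists (by simpa using hm) hex
  have P : t.HasPrimitiveVectorWith ((E ^ k) m) (μ + 2 * k) :=
    { ne_zero := hk
      lie_h := hpow k
      lie_e := by simpa [pow_succ'] using hk' }
  obtain ⟨n, hn⟩ := P.exists_nat
  exact ⟨k, n, (E ^ k) m, hk, by rw [hpow, hn], by simpa [pow_succ'] using hk', hn⟩

lemma casimir_neg_swap : casimir F E (-H) = casimir E F H := by
  simp [casimir, add_comm]

/-- On a highest weight vector of weight `n` the Casimir acts by `n + n² / 2`. Nilpotency forces `n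
= 0`, so raising from `μ` ends at weight `0`. -/
lemma exists_eigenvalue_eq_neg_two_mul [CharZero K] [FiniteDimensional K M]
    (t : IsSl2Triple H E F) (hΩ : IsNilpotent (casimir E F H)) {μ : K} {m : M} (hm : m ≠ 0)
    (hμ : H m = μ • m) : ∃ k : ℕ, μ + 2 * k = 0 := by
  obtain ⟨k, n, p, hp, hHp, hEp, hk⟩ := eigenvalue_add_two_mul_mem t hm hμ
  have hEF : E * F = H + F * E := by
    have := t.lie_e_f
    rw [Ring.lie_def] at this
    rw [← this]; abel
  have hΩp : casimir E F H p = ((n : K) + 2⁻¹ * (n * n)) • p := by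
    rw [casimir, hEF]
    simp [hEp, hHp, smul_smul, add_smul]
  have hev : (casimir E F H).HasEigenvalue ((n : K) + 2⁻¹ * (n * n)) :=
    Module.End.hasEigenvalue_of_hasEigenvector
      ⟨Module.End.mem_eigenspace_iff.mpr hΩp, hp⟩
  have h0 : (n : K) + 2⁻¹ * (n * n) = 0 := by
    exact (hev.isNilpotent_of_isNilpotent hΩ).eq_zero
  have h1 : ((n * (n + 2) : ℕ) : K) = 0 := by
    push_cast
    linear_combination 2 * h0
  have h2 : n = 0 := by simpa using Nat.cast_eq_zero.mp h1
  exact ⟨k, by simpa [h2] using hk⟩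

/-- The triple and its opposite give `μ = -2k` and `-μ = -2l`, so `0` is the only eigenvalue of `H`.
-/
lemma isNilpotent_of_isNilpotent_casimir [CharZero K] [IsAlgClosed K] [FiniteDimensional K M]
    (t : IsSl2Triple H E F) (hΩ : IsNilpotent (casimir E F H)) : IsNilpotent H := by
  have key : ∀ μ : K, H.HasEigenvalue μ → μ = 0 := by
    intro μ hμ
    obtain ⟨m, hm⟩ := hμ.exists_hasEigenvector
    obtain ⟨k, hk⟩ := exists_eigenvalue_eq_neg_two_mul t hΩ hm.2 hm.apply_eq_smul
    obtain ⟨l, hl⟩ := exists_eigenvalue_eq_neg_two_mul (μ := -μ) t.symm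
      (by rwa [casimir_neg_swap]) hm.2 (by simp [hm.apply_eq_smul])
    have : ((k + l : ℕ) : K) = 0 := by
      push_cast
      linear_combination (hk + hl) / 2
    have h2 : k + l = 0 := by exact_mod_cast this
    have : k = 0 := by omega
    simpa [this] using hk
  have htop : H.maxGenEigenspace 0 = ⊤ := by
    rw [← top_le_iff, ← Module.End.iSup_maxGenEigenspace_eq_top H]
    refine iSup_le fun μ ↦ ?_
    by_cases hμ : H.HasUnifEigenvalue μ ⊤
    · rw [key μ (hμ.lt one_pos)]
    · rw [show H.maxGenEigenspace μ = ⊥ from not_not.mp hμ]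
      exact bot_le
  refine ⟨Module.finrank K M, LinearMap.ext fun v ↦ ?_⟩
  have hv : v ∈ H.maxGenEigenspace 0 := htop ▸ Submodule.mem_top
  rw [Module.End.maxGenEigenspace_eq_genEigenspace_finrank, Module.End.mem_genEigenspace_nat] at hv
  simpa using hv

/-- A triple of operators satisfying the `sl₂` relations. -/
structure Relations (E F H : Module.End K M) : Prop where
  lie_e_f : E * F - F * E = H
  lie_h_e : H * E - E * H = (2 : K) • E
  lie_h_f : H * F - F * H = -((2 : K) • F)

lemma Relations.symm (r : Relations E F H) : Relations F E (-H) where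
  lie_e_f := by rw [← r.lie_e_f]; abel
  lie_h_e := by rw [← neg_inj, ← r.lie_h_f]; simp; abel
  lie_h_f := by rw [← r.lie_h_e]; simp; abel

/-- From `E (H + 2) = H E` follows `E (H + 2) ^ j = H ^ j E = 0` for large `j`, while `H + 2` is
invertible. -/
lemma Relations.eq_zero_of_isNilpotent [CharZero K] (r : Relations E F H) (hH : IsNilpotent H) :
    E = 0 := by
  have h1 : SemiconjBy E (H + algebraMap K _ 2) H := by
    have := r.lie_h_e
    rw [SemiconjBy, mul_add, ← Algebra.commutes, ← Algebra.smul_def, ← this]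
    abel
  obtain ⟨j, hj⟩ := id hH
  have h2 : E * (H + algebraMap K _ 2) ^ j = 0 := by
    rw [(h1.pow_right j).eq, hj, zero_mul]
  have hu : IsUnit (H + algebraMap K (Module.End K M) 2) :=
    hH.isUnit_add_right_of_commute
      ((IsUnit.mk0 (2 : K) two_ne_zero).map (algebraMap K (Module.End K M)))
      (Algebra.commutes _ _).symm
  exact ((hu.pow j).mul_left_eq_zero).mp h2

lemma Relations.eq_zero_of_isNilpotent_casimir [CharZero K] [IsAlgClosed K]
    [FiniteDimensional K M] (r : Relations E F H) (hΩ : IsNilpotent (casimir E F H)) :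
    E = 0 ∧ F = 0 ∧ H = 0 := by
  have hH : IsNilpotent H := by
    -- `IsSl2Triple` demands `H ≠ 0`; `Relations` does not, so that it survives restriction and
    -- quotients.
    by_cases h : H = 0
    · exact h ▸ IsNilpotent.zero
    · exact isNilpotent_of_isNilpotent_casimir (E := E) (F := F)
        ⟨h, r.lie_e_f, by rw [← Nat.cast_smul_eq_nsmul K]; exact_mod_cast r.lie_h_e,
          by rw [← Nat.cast_smul_eq_nsmul K]; exact_mod_cast r.lie_h_f⟩ hΩ
  have hE := r.eq_zero_of_isNilpotent hH
  exact ⟨hE, r.symm.eq_zero_of_isNilpotent hH.neg, by rw [← r.lie_e_f, hE]; simp⟩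

lemma Relations.commute_casimir [CharZero K] (r : Relations E F H) :
    Commute (casimir E F H) E := by
  have h1 := r.lie_e_f
  have h2 := r.lie_h_e
  rw [commute_iff_lie_eq, Ring.lie_def, casimir]
  linear_combination (norm := skip) -(E * h1) - h1 * E + (2⁻¹ : K) • (H * h2 + h2 * H)
  simp only [mul_sub, sub_mul, mul_add, add_mul, smul_add, smul_sub, mul_smul_comm,
    smul_mul_assoc, smul_smul, mul_assoc]
  norm_num
  abel

lemma Relations.commute_casimir_right [CharZero K] (r : Relations E F H) :
    Commute (casimir E F H) F := by
  have := r.symm.commute_casimir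
  rwa [casimir_neg_swap] at this

lemma Relations.commute_casimir_cartan [CharZero K] (r : Relations E F H) :
    Commute (casimir E F H) H := by
  have := (r.commute_casimir.mul_right r.commute_casimir_right).sub_right
    (r.commute_casimir_right.mul_right r.commute_casimir)
  rwa [r.lie_e_f] at this

/-- The vectors `e`, `f`, `h` are the values of a `1`-cocycle of `sl₂`. -/
structure IsCocycle (E F H : Module.End K M) (e f h : M) : Prop where
  apply_e_f : h = E f - F e
  apply_h_e : (2 : K) • e = H e - E h
  apply_h_f : -((2 : K) • f) = H f - F h

lemma IsCocycle.symm {e f h : M} (c : IsCocycle E F H e f h) : IsCocycle F E (-H) f e (-h) where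
  apply_e_f := by rw [c.apply_e_f]; abel
  apply_h_e := by rw [← neg_inj, c.apply_h_f]; simp; abel
  apply_h_f := by rw [c.apply_h_e]; simp; abel

/-- The vector whose coboundary is the image of a cocycle under the Casimir operator. -/
def contraction (E F H : Module.End K M) (e f h : M) : M :=
  E f + F e + (2⁻¹ : K) • H h

lemma contraction_neg_swap {e f h : M} :
    contraction F E (-H) f e (-h) = contraction E F H e f h := by
  simp [contraction, add_comm]

lemma Relations.apply_contraction [CharZero K] (r : Relations E F H) {e f h : M}
    (c : IsCocycle E F H e f h) : E (contraction E F H e f h) = casimir E F H e := by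
  have h1 : E (F e) - F (E e) = H e := by simpa using congr($(r.lie_e_f) e)
  have h2 : H (E h) - E (H h) = (2 : K) • E h := by simpa using congr($(r.lie_h_e) h)
  have h3 : E h = E (E f) - E (F e) := by rw [← map_sub, ← c.apply_e_f]
  have h4 : (2 : K) • H e = H (H e) - H (E h) := by rw [← map_smul, c.apply_h_e, map_sub]
  simp only [contraction, casimir, LinearMap.add_apply, LinearMap.smul_apply, map_add, map_smul,
    Module.End.mul_apply]
  linear_combination (norm := skip) h1 - (2⁻¹ : K) • h2 - h3 + (2⁻¹ : K) • h4
  simp only [smul_sub, smul_smul]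
  norm_num
  abel

lemma Relations.apply_contraction_right [CharZero K] (r : Relations E F H) {e f h : M}
    (c : IsCocycle E F H e f h) : F (contraction E F H e f h) = casimir E F H f := by
  rw [← contraction_neg_swap, ← casimir_neg_swap, r.symm.apply_contraction c.symm]

/-- With `Ω` the Casimir and `γ` the contraction, `Ω h = E Ω f - F Ω e = (E F - F E) γ = H γ`. -/
lemma Relations.apply_contraction_cartan [CharZero K] (r : Relations E F H) {e f h : M}
    (c : IsCocycle E F H e f h) : H (contraction E F H e f h) = casimir E F H h := by
  rw [c.apply_e_f, map_sub, ← Module.End.mul_apply (casimir E F H), ← Module.End.mul_apply,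
    r.commute_casimir.eq, r.commute_casimir_right.eq, Module.End.mul_apply, Module.End.mul_apply,
    ← r.apply_contraction c, ← r.apply_contraction_right c, ← r.lie_e_f, ← c.apply_e_f]
  simp

lemma IsCocycle.sub_coboundary (r : Relations E F H) {e f h : M} (c : IsCocycle E F H e f h)
    (a : M) : IsCocycle E F H (e - E a) (f - F a) (h - H a) where
  apply_e_f := by
    have h1 : E (F a) - F (E a) = H a := by simpa using congr($(r.lie_e_f) a)
    rw [c.apply_e_f, ← h1]
    simp only [map_sub]
    abel
  apply_h_e := by
    have h1 : H (E a) - E (H a) = (2 : K) • E a := by simpa using congr($(r.lie_h_e) a)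
    rw [smul_sub, c.apply_h_e, ← h1]
    simp only [map_sub]
    abel
  apply_h_f := by
    have h1 : H (F a) - F (H a) = -((2 : K) • F a) := by simpa using congr($(r.lie_h_f) a)
    rw [smul_sub, neg_sub, ← neg_sub_neg, c.apply_h_f, ← h1]
    simp only [map_sub]
    abel

lemma Relations.restrict (r : Relations E F H) {N : Submodule K M} (hE : ∀ x ∈ N, E x ∈ N)
    (hF : ∀ x ∈ N, F x ∈ N) (hH : ∀ x ∈ N, H x ∈ N) :
    Relations (E.restrict hE) (F.restrict hF) (H.restrict hH) where
  lie_e_f := by ext x; simpa using congr($(r.lie_e_f) x)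
  lie_h_e := by ext x; simpa using congr($(r.lie_h_e) x)
  lie_h_f := by ext x; simpa using congr($(r.lie_h_f) x)

/-- The kernel of a power of the Casimir is stable under the triple, and the Casimir is nilpotent on
it. -/
lemma Relations.apply_eq_zero_of_mem_ker_pow [CharZero K] [IsAlgClosed K]
    [FiniteDimensional K M] (r : Relations E F H) {n : ℕ} {v : M}
    (hv : (casimir E F H ^ n) v = 0) : E v = 0 ∧ F v = 0 ∧ H v = 0 := by
  have hN (T : Module.End K M) (hT : Commute (casimir E F H) T) (x : M)
      (hx : x ∈ LinearMap.ker (casimir E F H ^ n)) :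
      T x ∈ LinearMap.ker (casimir E F H ^ n) := by
    rw [LinearMap.mem_ker] at hx ⊢
    rw [← Module.End.mul_apply, (hT.pow_left n).eq, Module.End.mul_apply, hx, map_zero]
  have hE := hN E r.commute_casimir
  have hF := hN F r.commute_casimir_right
  have hH := hN H r.commute_casimir_cartan
  have hΩ : casimir (E.restrict hE) (F.restrict hF) (H.restrict hH) =
      (casimir E F H).restrict (hN _ (Commute.refl _)) := by
    rfl
  have := (r.restrict hE hF hH).eq_zero_of_isNilpotent_casimir <| by
    rw [hΩ]
    refine ⟨n, ?_⟩
    ext x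
    rw [Module.End.pow_restrict]
    simp
  obtain ⟨h1, h2, h3⟩ := this
  exact ⟨by simpa using congr(($h1 ⟨v, hv⟩ : M)), by simpa using congr(($h2 ⟨v, hv⟩ : M)),
    by simpa using congr(($h3 ⟨v, hv⟩ : M))⟩

/-- **Whitehead's first lemma** for `sl₂`: every `1`-cocycle is a coboundary. -/
theorem Relations.exists_eq_coboundary [CharZero K] [IsAlgClosed K] [FiniteDimensional K M]
    (r : Relations E F H) {e f h : M} (c : IsCocycle E F H e f h) :
    ∃ a : M, e = E a ∧ f = F a ∧ h = H a := by
  set Ω := casimir E F H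
  set γ := contraction E F H e f h
  -- The ranges of the powers of `Ω` stabilize at `n`, so `Ω ^ n γ = Ω ^ (n + 1) a` is solvable for
  -- `a`. After subtracting the coboundary of `a`, the cocycle is killed by `Ω ^ (n + 1)`.
  obtain ⟨n, hn⟩ := Filter.eventually_atTop.mp Ω.eventually_iInf_range_pow_eq
  have hmem : (Ω ^ n) γ ∈ LinearMap.range (Ω ^ (n + 1)) := by
    rw [← hn (n + 1) n.le_succ, hn n le_rfl]
    exact LinearMap.mem_range_self _ _
  obtain ⟨a, ha⟩ := hmem
  have hker {T : Module.End K M} {v : M} (hT : Commute Ω T) (hv : T γ = Ω v) :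
      (Ω ^ (n + 1)) (v - T a) = 0 := by
    rw [map_sub, ← Module.End.mul_apply _ T, (hT.pow_left (n + 1)).eq, Module.End.mul_apply, ha,
      ← Module.End.mul_apply, ← (hT.pow_left n).eq, Module.End.mul_apply, hv, pow_succ,
      Module.End.mul_apply, sub_self]
  have d := c.sub_coboundary r a
  obtain ⟨hEe, hFe, hHe⟩ := r.apply_eq_zero_of_mem_ker_pow
    (hker r.commute_casimir (r.apply_contraction c))
  obtain ⟨hEf, hFf, hHf⟩ := r.apply_eq_zero_of_mem_ker_pow
    (hker r.commute_casimir_right (r.apply_contraction_right c))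
  obtain ⟨hEh, hFh, hHh⟩ := r.apply_eq_zero_of_mem_ker_pow
    (hker r.commute_casimir_cartan (r.apply_contraction_cartan c))
  -- The corrected values are killed by `E`, `F`, `H`, so the cocycle identities make them zero.
  refine ⟨a, ?_, ?_, ?_⟩
  · simpa [hHe, hEh, sub_eq_zero] using d.apply_h_e
  · simpa [hHf, hFh, sub_eq_zero] using d.apply_h_f
  · simpa [hEf, hFe, sub_eq_zero] using d.apply_e_f

end SlTwoOperators

/-! ### Jacobi's formula for the derivative of a determinant. -/

/-- The product rule differentiates one column at a time, and Cramer's rule identifies each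
resulting determinant with a diagonal entry. -/
lemma Matrix.derivative_det {ι R : Type*} [Fintype ι] [DecidableEq ι] [CommRing R]
    (M : Matrix ι ι (Polynomial R)) :
    Polynomial.derivative M.det = (M.adjugate * M.map Polynomial.derivative).trace := by
  have h (i : ι) : (M.adjugate * M.map Polynomial.derivative) i i =
      (M.updateCol i fun j ↦ Polynomial.derivative (M j i)).det := by
    rw [← cramer_apply, cramer_eq_adjugate_mulVec]
    rfl
  simp only [trace, diag_apply, h]
  simp only [det_apply, Polynomial.derivative_sum, Polynomial.derivative_smul]
  rw [Finset.sum_comm]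
  refine Finset.sum_congr rfl fun σ _ ↦ ?_
  rw [← Finset.smul_sum, Polynomial.derivative_prod_finset]
  congr 1
  refine Finset.sum_congr rfl fun i _ ↦ ?_
  rw [← Finset.prod_erase_mul _ _ (Finset.mem_univ i)]
  congr 1
  · refine Finset.prod_congr rfl fun j hj ↦ ?_
    rw [updateCol_ne (Finset.ne_of_mem_erase hj)]
  · rw [updateCol_self]

/-! ### Crossed homomorphisms and their flow under inner automorphisms. -/

namespace LieAlgebra

variable {K s n : Type*} [Field K] [LieRing s] [LieAlgebra K s]
  [LieRing n] [LieAlgebra K n] (ψ : s →ₗ⁅K⁆ LieDerivation K n n)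

/-- A linear map `c : s → n` such that `x ↦ (c x, x)` is a homomorphism from `s` to the semidirect
sum of `n` and `s`. -/
def IsCrossedHom (c : s →ₗ[K] n) : Prop :=
  ∀ x y : s, c ⁅x, y⁆ = ⁅c x, c y⁆ + ψ x (c y) - ψ y (c x)

/-- The orbit map `x ↦ ψ x b`. -/
def orbitMap (b : n) : s →ₗ[K] n where
  toFun x := ψ x b
  map_add' _ _ := by simp
  map_smul' _ _ := by simp

@[simp] lemma orbitMap_apply (b : n) (x : s) : orbitMap ψ b x = ψ x b := rfl

/-- The Taylor coefficients of the curve `t ↦ exp (t • ad b)` acting on crossed homomorphisms. -/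
noncomputable def flowCoeff (c : s →ₗ[K] n) (b : n) : ℕ → s →ₗ[K] n
  | 0 => c
  | k + 1 => ((k + 1).factorial : K)⁻¹ •
      ((LieAlgebra.ad K n b ^ k) ∘ₗ (LieAlgebra.ad K n b ∘ₗ c - orbitMap ψ b))

/-- The crossed homomorphism obtained from `c` by applying `exp (t • ad b)`, where
`ad b ^ m = 0`. -/
noncomputable def flow (c : s →ₗ[K] n) (b : n) (m : ℕ) (t : K) : s →ₗ[K] n :=
  ∑ k ∈ Finset.range (m + 1), t ^ k • flowCoeff ψ c b k

variable {ψ}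

/-- The automorphism `exp (t • ad b)` of the semidirect sum fixes the `s`-component, so it carries
the graph of `c` to that of the flow. -/
lemma isCrossedHom_flow [CharZero K] {c : s →ₗ[K] n} (hc : IsCrossedHom ψ c) {b : n} {m : ℕ}
    (hb : LieAlgebra.ad K n b ^ m = 0) (t : K) : IsCrossedHom ψ (flow ψ c b m t) := by
  let _ : Module ℚ (n ⋊⁅ψ⁆ s) := Module.compHom _ (algebraMap ℚ K)
  let _ : LieAlgebra ℚ (n ⋊⁅ψ⁆ s) :=
    { lie_smul := fun q x y ↦ LieAlgebra.lie_smul (algebraMap ℚ K q) x y }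
  let D : LieDerivation K (n ⋊⁅ψ⁆ s) (n ⋊⁅ψ⁆ s) :=
    LieDerivation.ad K _ (SemiDirectSum.inl ψ (t • b))
  have hD (v : n) (x : s) : D ⟨v, x⟩ = ⟨t • (⁅b, v⁆ - ψ x b), 0⟩ := by
    simp [D, smul_sub]
  have hpow (k : ℕ) (v : n) (x : s) : (D.toLinearMap ^ (k + 1)) ⟨v, x⟩ =
      ⟨t ^ (k + 1) • (LieAlgebra.ad K n b ^ k) (⁅b, v⁆ - ψ x b), 0⟩ := by
    induction k with
    | zero => simpa using hD v x
    | succ k ih =>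
      rw [pow_succ', Module.End.mul_apply, ih]
      refine (hD _ _).trans ?_
      rw [pow_succ' (LieAlgebra.ad K n b), Module.End.mul_apply, LieAlgebra.ad_apply]
      simp [smul_smul, pow_succ']
  -- The first application of `D` uses no power of `ad b`, hence the exponent `m + 1`.
  have hDm : D.toLinearMap ^ (m + 1) = 0 := by
    ext ⟨v, x⟩ <;> rw [hpow, hb] <;> simp
  have hnil : IsNilpotent D.toLinearMap := ⟨m + 1, hDm⟩
  have hexp (x : s) : D.exp hnil ⟨c x, x⟩ = ⟨flow ψ c b m t x, x⟩ := by
    have h1 : D.exp hnil ⟨c x, x⟩ = ∑ i ∈ Finset.range (m + 1),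
        (algebraMap ℚ K (i.factorial : ℚ)⁻¹) • (D.toLinearMap ^ i) ⟨c x, x⟩ := by
      rw [LieDerivation.exp_map_apply D hnil, IsNilpotent.exp_eq_sum hDm, LinearMap.sum_apply]
      rfl
    rw [h1, Finset.sum_range_succ', flow, Finset.sum_range_succ', LinearMap.add_apply]
    have h2 : ∀ k, (algebraMap ℚ K ((k + 1).factorial : ℚ)⁻¹) • (D.toLinearMap ^ (k + 1)) ⟨c x, x⟩ =
        SemiDirectSum.inl ψ ((t ^ (k + 1) • flowCoeff ψ c b (k + 1)) x) := by
      intro k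
      rw [hpow]
      simp [flowCoeff, smul_smul, mul_comm]
    rw [Finset.sum_congr rfl fun k _ ↦ h2 k, ← map_sum, LinearMap.sum_apply,
      SemiDirectSum.inl_eq_mk]
    simp [flowCoeff]
  intro x y
  have h := (D.exp hnil).map_lie ⟨c x, x⟩ ⟨c y, y⟩
  have h2 : ⁅(⟨c x, x⟩ : n ⋊⁅ψ⁆ s), (⟨c y, y⟩ : n ⋊⁅ψ⁆ s)⁆ = ⟨c ⁅x, y⁆, ⁅x, y⁆⟩ := by
    rw [hc x y]; rfl
  rw [h2, hexp, hexp, hexp] at h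
  exact congr(SemiDirectSum.left $h)

/-- Coefficientwise form of the differential equation `c_t' = ad b ∘ c_t - orbitMap ψ b`. -/
lemma succ_smul_flowCoeff_succ [CharZero K] (c : s →ₗ[K] n) (b : n) (k : ℕ) :
    (k + 1 : K) • flowCoeff ψ c b (k + 1) =
      LieAlgebra.ad K n b ∘ₗ flowCoeff ψ c b k - if k = 0 then orbitMap ψ b else 0 := by
  cases k with
  | zero => ext x; simp [flowCoeff]
  | succ k =>
    ext x
    have h : ((k : K) + 1 + 1) * ((k + 1 + 1).factorial : K)⁻¹ = ((k + 1).factorial : K)⁻¹ := by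
      rw [Nat.factorial_succ (k + 1)]
      push_cast
      have : (k : K) + 1 + 1 ≠ 0 := by exact_mod_cast (k + 1).succ_ne_zero
      field_simp
    simp [flowCoeff, smul_smul, h, pow_succ']

lemma exists_flow_eq (c : s →ₗ[K] n) (b : n) (m : ℕ) (x : s) :
    ∃ w : n, flow ψ c b (m + 1) 1 x = c x - ψ x b + ⁅b, w⁆ := by
  have h (k : ℕ) : ∃ w : n, flowCoeff ψ c b (k + 2) x = ⁅b, w⁆ :=
    ⟨((k + 2).factorial : K)⁻¹ • (LieAlgebra.ad K n b ^ k) (⁅b, c x⁆ - ψ x b), by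
      simp [flowCoeff, pow_succ']⟩
  choose w hw using h
  refine ⟨∑ k ∈ Finset.range m, w k + c x, ?_⟩
  rw [flow, Finset.sum_range_succ', Finset.sum_range_succ']
  simp only [one_pow, one_smul, LinearMap.add_apply, LinearMap.sum_apply, hw]
  simp [flowCoeff, lie_sum]
  abel

/-- Writing `b = c y`, the crossed identity expresses this operator through conjugates of `ad (c y)`
and `ψ y`, and `ad y`, all traceless. -/
lemma trace_symm_comp_orbitMap (hs : ∀ x : s, LinearMap.trace K s (LieAlgebra.ad K s x) = 0)
    (hψ : ∀ x : s, LinearMap.trace K n (ψ x).toLinearMap = 0)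
    (hn : ∀ x : n, LinearMap.trace K n (LieAlgebra.ad K n x) = 0)
    {c : s ≃ₗ[K] n} (hc : IsCrossedHom ψ c.toLinearMap) (b : n) :
    LinearMap.trace K s (c.symm.toLinearMap ∘ₗ orbitMap ψ b) = 0 := by
  obtain ⟨y, rfl⟩ := c.surjective b
  have h : c.symm.toLinearMap ∘ₗ orbitMap ψ (c y) =
      c.symm.conj (LieAlgebra.ad K n (c y)) + c.symm.conj (ψ y).toLinearMap
        - LieAlgebra.ad K s y := by
    ext x
    apply c.injective
    have := hc y x
    simp at this
    simp [LinearEquiv.conj_apply, this]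
  rw [h, map_sub, map_add, LinearMap.trace_conj', LinearMap.trace_conj', hs, hψ, hn]
  simp

open Polynomial in
/-- The flow of an element with nilpotent adjoint action preserves the determinant of crossed
homomorphisms, if all actions involved are traceless. -/
lemma det_toMatrix_flow {ι : Type*} [Fintype ι] [DecidableEq ι] [CharZero K]
    (hs : ∀ x : s, LinearMap.trace K s (LieAlgebra.ad K s x) = 0)
    (hψ : ∀ x : s, LinearMap.trace K n (ψ x).toLinearMap = 0)
    (hn : ∀ x : n, LinearMap.trace K n (LieAlgebra.ad K n x) = 0)
    (e₁ : Module.Basis ι K s) (e₂ : Module.Basis ι K n)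
    {c : s →ₗ[K] n} (hc : IsCrossedHom ψ c)
    (hdet : (LinearMap.toMatrix e₁ e₂ c).det ≠ 0) {b : n} {m : ℕ}
    (hb : LieAlgebra.ad K n b ^ m = 0) (t : K) :
    (LinearMap.toMatrix e₁ e₂ (flow ψ c b m t)).det = (LinearMap.toMatrix e₁ e₂ c).det := by
  let M : Matrix ι ι K[X] := ∑ k ∈ Finset.range (m + 1),
    (X ^ k : K[X]) • (LinearMap.toMatrix e₁ e₂ (flowCoeff ψ c b k)).map Polynomial.C
  have hM (t : K) : M.map (Polynomial.eval t) = LinearMap.toMatrix e₁ e₂ (flow ψ c b m t) := by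
    ext i j
    simp [M, flow, Matrix.sum_apply, eval_finsetSum]
    exact Finset.sum_congr rfl fun _ _ ↦ mul_comm _ _
  have hM' (t : K) : (M.map derivative).map (Polynomial.eval t) = LinearMap.toMatrix e₁ e₂
      (LieAlgebra.ad K n b ∘ₗ flow ψ c b m t - orbitMap ψ b) := by
    have h1 : LieAlgebra.ad K n b ∘ₗ flow ψ c b m t - orbitMap ψ b =
        ∑ k ∈ Finset.range (m + 1), ((k : K) * t ^ (k - 1)) • flowCoeff ψ c b k := by
      have h2 : flowCoeff ψ c b (m + 1) = 0 := by
        rw [flowCoeff, hb, LinearMap.zero_comp, smul_zero]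
      symm
      calc ∑ k ∈ Finset.range (m + 1), ((k : K) * t ^ (k - 1)) • flowCoeff ψ c b k
          = ∑ k ∈ Finset.range (m + 1), t ^ k • (k + 1 : K) • flowCoeff ψ c b (k + 1) := by
            rw [Finset.sum_range_succ', Finset.sum_range_succ, h2]
            simp [smul_smul, mul_comm]
        _ = ∑ k ∈ Finset.range (m + 1), (LieAlgebra.ad K n b ∘ₗ (t ^ k • flowCoeff ψ c b k)
              - if k = 0 then orbitMap ψ b else 0) := by
            refine Finset.sum_congr rfl fun k _ ↦ ?_
            rw [succ_smul_flowCoeff_succ, smul_sub, LinearMap.comp_smul]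
            split_ifs with hk <;> simp [hk]
        _ = _ := by
            ext x
            simp [flow, Finset.sum_sub_distrib]
    rw [h1]
    ext i j
    simp [M, Matrix.sum_apply, eval_finsetSum, derivative_X_pow]
    exact Finset.sum_congr rfl fun _ _ ↦ mul_comm _ _
  have hdetM (t : K) : M.det.eval t = (LinearMap.toMatrix e₁ e₂ (flow ψ c b m t)).det := by
    rw [← hM, ← coe_evalRingHom, RingHom.map_det]
    rfl
  have h0 : flow ψ c b m 0 = c := by
    rw [flow, Finset.sum_range_succ']
    simp [flowCoeff]
  -- Where `c_t` is invertible, Jacobi's formula gives `det c_t * tr (c_t⁻¹ c_t')`, and both terms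
  -- of `c_t'` contribute trace zero.
  have hder (t : K) (ht : M.det.eval t ≠ 0) : (derivative M.det).eval t = 0 := by
    rw [hdetM] at ht
    let g : s ≃ₗ[K] n := LinearEquiv.ofIsUnitDet (v := e₁) (v' := e₂) ht.isUnit
    have hg : g.toLinearMap = flow ψ c b m t := by ext; rfl
    have hinv : LinearMap.toMatrix e₂ e₁ g.symm.toLinearMap =
        (LinearMap.toMatrix e₁ e₂ (flow ψ c b m t))⁻¹ := by
      refine (Matrix.inv_eq_left_inv ?_).symm
      rw [← hg, ← LinearMap.toMatrix_comp]
      simp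
    have hadj : (LinearMap.toMatrix e₁ e₂ (flow ψ c b m t)).adjugate =
        (LinearMap.toMatrix e₁ e₂ (flow ψ c b m t)).det •
          LinearMap.toMatrix e₂ e₁ g.symm.toLinearMap := by
      rw [hinv, Matrix.inv_def, smul_smul, Ring.mul_inverse_cancel _ ht.isUnit, one_smul]
    have htr : (derivative M.det).eval t = ((LinearMap.toMatrix e₁ e₂ (flow ψ c b m t)).adjugate *
        LinearMap.toMatrix e₁ e₂
          (LieAlgebra.ad K n b ∘ₗ flow ψ c b m t - orbitMap ψ b)).trace := by
      rw [Matrix.derivative_det, ← hM', ← hM, ← coe_evalRingHom]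
      have := RingHom.map_adjugate (evalRingHom t) M
      simp only [RingHom.mapMatrix_apply] at this
      rw [← this, ← Matrix.map_mul, AddMonoidHom.map_trace]
    rw [htr, hadj, smul_mul_assoc, ← LinearMap.toMatrix_comp, Matrix.trace_smul,
      ← LinearMap.trace_eq_matrix_trace, LinearMap.comp_sub, map_sub,
      trace_symm_comp_orbitMap hs hψ hn (hg ▸ isCrossedHom_flow hc hb t), ← hg]
    have : g.symm.toLinearMap ∘ₗ LieAlgebra.ad K n b ∘ₗ g.toLinearMap =
        g.symm.conj (LieAlgebra.ad K n b) := by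
      ext; simp [LinearEquiv.conj_apply]
    rw [this, LinearMap.trace_conj', hn]
    simp
  have hne : M.det ≠ 0 := by
    intro h
    have := hdetM 0
    rw [h, h0, eval_zero] at this
    exact hdet this.symm
  -- The derivative vanishes wherever the determinant does not, so their product is zero at every
  -- point of an infinite field.
  have hzero : derivative M.det = 0 := by
    have : M.det * derivative M.det = 0 := by
      refine Polynomial.funext fun t ↦ ?_
      by_cases ht : M.det.eval t = 0
      · simp [ht]
      · simp [hder t ht]
    exact (mul_eq_zero.mp this).resolve_left hne
  have hconst := eq_C_of_natDegree_eq_zero (derivative_eq_zero.mp hzero)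
  rw [← hdetM, ← h0, ← hdetM, hconst, eval_C, eval_C]

end LieAlgebra

/-! ### Whitehead's lemma on subquotients. -/

namespace SlTwoOperators

variable {K M : Type*} [Field K] [AddCommGroup M] [Module K M]
variable {E F H : Module.End K M}

lemma Relations.mapQ (r : Relations E F H) {N : Submodule K M} (hE : N ≤ N.comap E)
    (hF : N ≤ N.comap F) (hH : N ≤ N.comap H) :
    Relations (N.mapQ N E hE) (N.mapQ N F hF) (N.mapQ N H hH) where
  lie_e_f := by
    refine Submodule.linearMap_qext _ (LinearMap.ext fun x ↦ ?_)
    simpa using congr(N.mkQ ($(r.lie_e_f) x))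
  lie_h_e := by
    refine Submodule.linearMap_qext _ (LinearMap.ext fun x ↦ ?_)
    simpa using congr(N.mkQ ($(r.lie_h_e) x))
  lie_h_f := by
    refine Submodule.linearMap_qext _ (LinearMap.ext fun x ↦ ?_)
    simpa using congr(N.mkQ ($(r.lie_h_f) x))

/-- Whitehead's first lemma for `sl₂` acting on a subquotient `A / B`. -/
theorem Relations.exists_sub_mem [CharZero K] [IsAlgClosed K] [FiniteDimensional K M]
    (r : Relations E F H) {A B : Submodule K M}
    (hA : ∀ x ∈ A, E x ∈ A ∧ F x ∈ A ∧ H x ∈ A) (hB : ∀ x ∈ B, E x ∈ B ∧ F x ∈ B ∧ H x ∈ B)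
    {e f h : M} (he : e ∈ A) (hf : f ∈ A) (hh : h ∈ A) (hef : h - (E f - F e) ∈ B)
    (hhe : (2 : K) • e - (H e - E h) ∈ B) (hhf : -((2 : K) • f) - (H f - F h) ∈ B) :
    ∃ a ∈ A, e - E a ∈ B ∧ f - F a ∈ B ∧ h - H a ∈ B := by
  have rA := r.restrict (fun x hx ↦ (hA x hx).1) (fun x hx ↦ (hA x hx).2.1)
    (fun x hx ↦ (hA x hx).2.2)
  set N := B.comap A.subtype
  have rQ := rA.mapQ (N := N) (fun x hx ↦ (hB _ hx).1) (fun x hx ↦ (hB _ hx).2.1)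
    (fun x hx ↦ (hB _ hx).2.2)
  have hmk (x y : A) (hxy : (x : M) - y ∈ B) : N.mkQ x = N.mkQ y := by
    rw [Submodule.mkQ_apply, Submodule.mkQ_apply, Submodule.Quotient.eq]
    exact hxy
  have hmk' (x y : A) (hxy : N.mkQ x = N.mkQ y) : (x : M) - y ∈ B := by
    rwa [Submodule.mkQ_apply, Submodule.mkQ_apply, Submodule.Quotient.eq] at hxy
  obtain ⟨q, h1, h2, h3⟩ := rQ.exists_eq_coboundary (e := N.mkQ ⟨e, he⟩) (f := N.mkQ ⟨f, hf⟩)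
    (h := N.mkQ ⟨h, hh⟩)
    { apply_e_f := hmk ⟨h, hh⟩ (⟨E f, (hA f hf).1⟩ - ⟨F e, (hA e he).2.1⟩) hef
      apply_h_e := (map_smul N.mkQ _ _).symm.trans <| hmk ((2 : K) • ⟨e, he⟩) (⟨H e, (hA e he).2.2⟩ - ⟨E h, (hA h hh).1⟩) hhe
      apply_h_f := (map_neg N.mkQ ((2 : K) • ⟨f, hf⟩)).symm.trans <| hmk (-((2 : K) • ⟨f, hf⟩)) (⟨H f, (hA f hf).2.2⟩ - ⟨F h, (hA h hh).2.1⟩) hhf }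
  obtain ⟨a, rfl⟩ := N.mkQ_surjective q
  exact ⟨a, a.2, hmk' ⟨e, he⟩ ⟨E a, (hA a a.2).1⟩ h1, hmk' ⟨f, hf⟩ ⟨F a, (hA a a.2).2.1⟩ h2,
    hmk' ⟨h, hh⟩ ⟨H a, (hA a a.2).2.2⟩ h3⟩

end SlTwoOperators

/-! ### Crossed homomorphisms from semisimple to nilpotent Lie algebras. -/

namespace LieAlgebra

open LieModule

attribute [local instance 100] LieRing.ofAssociativeRing

section Killing

variable {K s : Type*} [Field K] [LieRing s] [LieAlgebra K s]

/-- If `x` is Killing-orthogonal to all brackets, invariance puts every `⁅x, y⁆` in the kernel of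
the form, so `x` is central and hence zero. -/
lemma IsKilling.derivedSeries_one_eq_top [FiniteDimensional K s] [IsKilling K s] : derivedSeries K s 1 = ⊤ := by
  have h : LieIdeal.killingCompl K s (derivedSeries K s 1) = ⊥ := by
    rw [LieSubmodule.eq_bot_iff]
    intro x hx
    rw [LieIdeal.mem_killingCompl] at hx
    have hx0 (y : s) : ⁅x, y⁆ = 0 := by
      have : ⁅x, y⁆ ∈ LinearMap.ker (killingForm K s) := by
        rw [LinearMap.mem_ker]
        ext z
        rw [traceForm_apply_lie_apply, traceForm_comm]
        exact hx _ (LieSubmodule.lie_mem_lie (LieSubmodule.mem_top y) (LieSubmodule.mem_top z))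
      simpa using this
    have : x ∈ center K s := fun y ↦ by rw [← lie_skew, hx0, neg_zero]
    simpa using this
  have := (LieIdeal.isCompl_killingCompl (K := K) (derivedSeries K s 1)).sup_eq_top
  rwa [h, sup_bot_eq] at this

lemma trace_eq_zero_of_derivedSeries_eq_top {V : Type*} [AddCommGroup V] [Module K V]
    (hs : derivedSeries K s 1 = ⊤) (ρ : s →ₗ[K] Module.End K V)
    (hρ : ∀ x y, ρ ⁅x, y⁆ = ρ x * ρ y - ρ y * ρ x) (x : s) :
    LinearMap.trace K V (ρ x) = 0 := by
  have hx : x ∈ Submodule.span K {⁅x, y⁆ | (x : s) (y : s)} := by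
    rw [← coe_derivedSeries_one_eq, hs]
    trivial
  induction hx using Submodule.span_induction with
  | zero => simp
  | add u w _ _ hu hw => rw [map_add, map_add, hu, hw, add_zero]
  | smul t u _ hu => rw [map_smul, map_smul, hu, smul_zero]
  | mem u hu =>
    obtain ⟨y, z, rfl⟩ := hu
    rw [hρ, map_sub, LinearMap.trace_mul_comm, sub_self]

lemma exists_isSl2Triple [FiniteDimensional K s] [IsAlgClosed K] [CharZero K] [IsKilling K s] [Nontrivial s] :
    ∃ h e f : s, IsSl2Triple h e f := by
  obtain ⟨x, hx⟩ := exists_isCartanSubalgebra_engel K s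
  set H := LieSubalgebra.engel K x
  have hα : ∃ α : Weight K H s, α.IsNonZero := by
    by_contra! hα
    have hspan := IsKilling.span_weight_isNonZero_eq_top K s H
    have hempty : {α : Weight K H s | α.IsNonZero} = ∅ := by
      ext α
      simpa using hα α
    rw [hempty, Set.image_empty, Submodule.span_empty] at hspan
    obtain ⟨v, hv⟩ := exists_ne (0 : H)
    refine hv ((Module.forall_dual_apply_eq_zero_iff K v).mp fun φ ↦ ?_)
    have hφ : φ ∈ (⊤ : Submodule K (Module.Dual K H)) := trivial
    rw [← hspan, Submodule.mem_bot] at hφ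
    rw [hφ, LinearMap.zero_apply]
  obtain ⟨α, hα⟩ := hα
  obtain ⟨h, e, f, t, -⟩ := IsKilling.exists_isSl2Triple_of_weight_isNonZero hα
  exact ⟨h, e, f, t⟩

end Killing

variable {K s n : Type*} [Field K] [LieRing s] [LieAlgebra K s] [LieRing n] [LieAlgebra K n]

lemma _root_.LieDerivation.apply_mem_lowerCentralSeries (D : LieDerivation K n n) {k : ℕ} {v : n}
    (hv : v ∈ lowerCentralSeries K n n k) : D v ∈ lowerCentralSeries K n n k := by
  induction k generalizing v with
  | zero => trivial
  | succ k ih =>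
    rw [lowerCentralSeries_succ, ← LieSubmodule.mem_toSubmodule,
      LieSubmodule.lieIdeal_oper_eq_linear_span'] at hv ⊢
    induction hv using Submodule.span_induction with
    | zero => simp
    | add u w _ _ hu hw => rw [map_add]; exact add_mem hu hw
    | smul t u _ hu => rw [map_smul]; exact Submodule.smul_mem _ t hu
    | mem u hu =>
      obtain ⟨x, hx, y, hy, rfl⟩ := hu
      rw [D.apply_lie_eq_add]
      exact add_mem (Submodule.subset_span ⟨x, hx, _, ih hy, rfl⟩)
        (Submodule.subset_span ⟨_, trivial, _, hy, rfl⟩)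

lemma lie_mem_lowerCentralSeries_succ {k : ℕ} {b : n} (hb : b ∈ lowerCentralSeries K n n k)
    (w : n) : ⁅b, w⁆ ∈ lowerCentralSeries K n n (k + 1) := by
  rw [← lie_skew, lowerCentralSeries_succ]
  exact neg_mem (LieSubmodule.lie_mem_lie (LieSubmodule.mem_top w) hb)

/-- There is no bijective crossed homomorphism from a nonzero semisimple Lie algebra to a
nilpotent Lie algebra. -/
theorem not_bijective_of_isCrossedHom [CharZero K] [IsAlgClosed K] [FiniteDimensional K s]
    [FiniteDimensional K n] [IsKilling K s] [Nontrivial s] [LieRing.IsNilpotent n]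
    (ψ : s →ₗ⁅K⁆ LieDerivation K n n) {c : s →ₗ[K] n} (hc : IsCrossedHom ψ c) :
    ¬ Function.Bijective c := by
  intro hbij
  have hperf : derivedSeries K s 1 = ⊤ := IsKilling.derivedSeries_one_eq_top
  have hs := trace_eq_zero_of_derivedSeries_eq_top hperf (LieAlgebra.ad K s).toLinearMap
    fun x y ↦ by rw [← Ring.lie_def]; exact LieHom.map_lie _ x y
  let ρ : s →ₗ[K] Module.End K n :=
    { toFun := fun x ↦ (ψ x).toLinearMap
      map_add' := fun x y ↦ by simp
      map_smul' := fun x y ↦ by simp }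
  have hρ (x y : s) : ρ ⁅x, y⁆ = ρ x * ρ y - ρ y * ρ x := by
    ext v
    simp [ρ, Ring.lie_def]
  have hψ := trace_eq_zero_of_derivedSeries_eq_top hperf ρ hρ
  have had (x : n) : IsNilpotent (LieAlgebra.ad K n x) :=
    LieModule.isNilpotent_toEnd_of_isNilpotent K n n x
  have hn (x : n) : LinearMap.trace K n (LieAlgebra.ad K n x) = 0 :=
    (LinearMap.isNilpotent_trace_of_isNilpotent (had x)).eq_zero
  obtain ⟨h, e, f, t⟩ := exists_isSl2Triple (K := K) (s := s)
  have r : SlTwoOperators.Relations (ρ e) (ρ f) (ρ h) :=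
    { lie_e_f := by rw [← hρ, t.lie_e_f]
      lie_h_e := by rw [← hρ, t.lie_h_e_smul K, map_smul]
      lie_h_f := by rw [← hρ, t.lie_lie_smul_f K, map_neg, map_smul] }
  -- The second basis is the image of the first under `c`, so `c` starts with determinant `1`.
  let e₁ := Module.finBasis K s
  let e₂ := e₁.map (LinearEquiv.ofBijective c hbij)
  have key (k : ℕ) : ∃ c' : s →ₗ[K] n, IsCrossedHom ψ c' ∧
      (LinearMap.toMatrix e₁ e₂ c').det ≠ 0 ∧ c' e ∈ lowerCentralSeries K n n k ∧
      c' f ∈ lowerCentralSeries K n n k ∧ c' h ∈ lowerCentralSeries K n n k := by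
    induction k with
    | zero =>
      refine ⟨c, hc, ?_, trivial, trivial, trivial⟩
      have : LinearMap.toMatrix e₁ e₂ c = 1 := by
        ext i j
        simp [LinearMap.toMatrix_apply, e₂, Matrix.one_apply, Finsupp.single_apply, eq_comm]
      simp [this]
    | succ k ih =>
      obtain ⟨c', hc', hdet, hce, hcf, hch⟩ := ih
      have hρmem (j : ℕ) (x : s) : ∀ v ∈ (lowerCentralSeries K n n j).toSubmodule,
          ρ x v ∈ (lowerCentralSeries K n n j).toSubmodule :=
        fun v hv ↦ (ψ x).apply_mem_lowerCentralSeries hv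
      have hbr (x y : s) (hx : c' x ∈ lowerCentralSeries K n n k) :
          c' ⁅x, y⁆ - (ρ x (c' y) - ρ y (c' x)) ∈
            (lowerCentralSeries K n n (k + 1)).toSubmodule := by
        have : c' ⁅x, y⁆ - (ρ x (c' y) - ρ y (c' x)) = ⁅c' x, c' y⁆ := by
          rw [hc' x y]
          simp only [ρ, LinearMap.coe_mk, AddHom.coe_mk, LieDerivation.coeFn_coe]
          abel
        rw [this]
        exact lie_mem_lowerCentralSeries_succ hx _
      -- The quadratic term `⁅c' x, c' y⁆` dies modulo term `k + 1`, which leaves the linear cocycle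
      -- identities.
      obtain ⟨b, hb, hbe, hbf, hbh⟩ := r.exists_sub_mem
        (fun v hv ↦ ⟨hρmem k e v hv, hρmem k f v hv, hρmem k h v hv⟩)
        (fun v hv ↦ ⟨hρmem (k + 1) e v hv, hρmem (k + 1) f v hv, hρmem (k + 1) h v hv⟩)
        hce hcf hch (t.lie_e_f ▸ hbr e f hce)
        (by simpa [t.lie_h_e_smul K] using hbr h e hch)
        (by simpa [t.lie_lie_smul_f K] using hbr h f hch)
      obtain ⟨m, hm⟩ := had b
      -- The larger exponent ensures that the truncated flow contains its first-order term.
      have hm' : LieAlgebra.ad K n b ^ (m + 1) = 0 := by rw [pow_succ, hm, zero_mul]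
      have hflow (x : s) (hx : c' x - ρ x b ∈ lowerCentralSeries K n n (k + 1)) :
          flow ψ c' b (m + 1) 1 x ∈ lowerCentralSeries K n n (k + 1) := by
        obtain ⟨w, hw⟩ := exists_flow_eq (ψ := ψ) c' b m x
        rw [hw]
        exact add_mem hx (lie_mem_lowerCentralSeries_succ hb w)
      refine ⟨flow ψ c' b (m + 1) 1, isCrossedHom_flow hc' hm' 1, ?_, hflow e hbe, hflow f hbf,
        hflow h hbh⟩
      rwa [det_toMatrix_flow hs hψ hn e₁ e₂ hc' hdet hm']
  obtain ⟨k, hk⟩ := IsNilpotent.nilpotent K n n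
  obtain ⟨c', -, hdet, hce, -⟩ := key k
  rw [hk, LieSubmodule.mem_bot] at hce
  exact t.e_ne_zero <| (LinearEquiv.ofIsUnitDet hdet.isUnit).injective <|
    hce.trans (map_zero c').symm

end LieAlgebra

/-! ### Reductive Lie algebras and the dimension count. -/

namespace LieAlgebra

open LieModule

section Reductive

variable {K G : Type*} [Field K] [LieRing G] [LieAlgebra K G]

/-- The projection of a Lie algebra onto its quotient by the center. -/
def toQuotientCenter (K G : Type*) [Field K] [LieRing G] [LieAlgebra K G] :
    G →ₗ⁅K⁆ G ⧸ center K G where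
  toLinearMap := (LieSubmodule.Quotient.mk' (center K G) : G →ₗ[K] G ⧸ center K G)
  map_lie' := fun {x y} ↦ LieSubmodule.Quotient.mk_bracket _ x y

lemma toQuotientCenter_surjective : Function.Surjective (toQuotientCenter K G) :=
  LieSubmodule.Quotient.surjective_mk' (center K G)

lemma toQuotientCenter_eq_zero_iff {x : G} : toQuotientCenter K G x = 0 ↔ x ∈ center K G :=
  LieSubmodule.Quotient.mk_eq_zero (center K G)

/-- The preimage of a solvable ideal is an extension by central elements, hence solvable, hence
inside the radical, which is the center. -/
instance hasTrivialRadical_quotient_center [FiniteDimensional K G] [HasCentralRadical K G] :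
    HasTrivialRadical K (G ⧸ center K G) := by
  rw [hasTrivialRadical_iff_no_solvable_ideals]
  intro I hI
  let J : LieIdeal K G := I.comap (toQuotientCenter K G)
  have hJ (x : J) : toQuotientCenter K G x.1 ∈ I := LieIdeal.mem_comap.mp x.2
  let f : J →ₗ⁅K⁆ I :=
    { toFun := fun x ↦ ⟨toQuotientCenter K G x.1, hJ x⟩
      map_add' := fun x y ↦ Subtype.ext (map_add (toQuotientCenter K G) x.1 y.1)
      map_smul' := fun t x ↦ Subtype.ext (map_smul (toQuotientCenter K G) t x.1)
      map_lie' := fun {x y} ↦ Subtype.ext (LieHom.map_lie (toQuotientCenter K G) x.1 y.1) }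
  have : IsLieAbelian f.ker := by
    refine ⟨fun x y ↦ ?_⟩
    have hy : toQuotientCenter K G y.1.1 = 0 := congr(($(y.2) : I).1)
    rw [toQuotientCenter_eq_zero_iff] at hy
    exact Subtype.ext (Subtype.ext (hy x.1.1))
  have : IsSolvable J := f.isSolvable_of_isSolvable_ker
  rw [LieIdeal.solvable_iff_le_radical, HasCentralRadical.radical_eq_center] at this
  rw [LieSubmodule.eq_bot_iff]
  intro q hq
  obtain ⟨x, rfl⟩ := toQuotientCenter_surjective (K := K) q
  exact toQuotientCenter_eq_zero_iff.mpr (this (LieIdeal.mem_comap.mpr hq))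

lemma derivedSeries_one_sup_center [CharZero K] [FiniteDimensional K G] [HasCentralRadical K G] :
    (derivedSeries K G 1).toSubmodule ⊔ (center K G).toSubmodule = ⊤ := by
  rw [eq_top_iff]
  intro x _
  have h : toQuotientCenter K G x ∈ (derivedSeries K G 1).map (toQuotientCenter K G) := by
    rw [LieIdeal.derivedSeries_map_eq 1 toQuotientCenter_surjective,
      IsKilling.derivedSeries_one_eq_top]
    trivial
  obtain ⟨y, hy⟩ := LieIdeal.mem_map_of_surjective toQuotientCenter_surjective h
  rw [Submodule.mem_sup]
  refine ⟨y.1, y.2, x - y.1, ?_, by abel⟩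
  refine toQuotientCenter_eq_zero_iff.mp ?_
  rw [map_sub, hy, sub_self]

lemma isKilling_derivedSeries_one [CharZero K] [FiniteDimensional K G] [HasCentralRadical K G]
    (h : (derivedSeries K G 1).toSubmodule ⊓ (center K G).toSubmodule = ⊥) :
    IsKilling K (derivedSeries K G 1) := by
  let f : derivedSeries K G 1 →ₗ⁅K⁆ G ⧸ center K G :=
    (toQuotientCenter K G).comp (derivedSeries K G 1).incl
  have hf : Function.Bijective f := by
    constructor
    · refine (injective_iff_map_eq_zero f).mpr fun x hx ↦ Subtype.ext ?_
      have : x.1 ∈ (derivedSeries K G 1).toSubmodule ⊓ (center K G).toSubmodule :=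
        ⟨x.2, toQuotientCenter_eq_zero_iff.mp hx⟩
      rwa [h, Submodule.mem_bot] at this
    · intro q
      obtain ⟨x, rfl⟩ := toQuotientCenter_surjective (K := K) q
      obtain ⟨y, hy, z, hz, rfl⟩ := Submodule.mem_sup.mp
        (derivedSeries_one_sup_center (K := K) (G := G) ▸ Submodule.mem_top (x := x))
      refine ⟨⟨y, hy⟩, ?_⟩
      rw [map_add, toQuotientCenter_eq_zero_iff.mpr hz, add_zero]
      rfl
  exact isKilling_of_equiv (LieEquiv.ofBijective f hf).symm

end Reductive

/-- There is no bijective crossed homomorphism from a reductive Lie algebra with one-dimensional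
center to a solvable Lie algebra that is not nilpotent. -/
theorem not_bijective_of_isCrossedHom_of_hasCentralRadical {K G N : Type*} [Field K] [CharZero K]
    [IsAlgClosed K] [LieRing G] [LieAlgebra K G] [LieRing N] [LieAlgebra K N]
    [FiniteDimensional K G] [FiniteDimensional K N] [HasCentralRadical K G]
    (hG : Module.finrank K (center K G) = 1) [IsSolvable N] (hN : ¬ LieRing.IsNilpotent N)
    (ψ : G →ₗ⁅K⁆ LieDerivation K N N) {c : G →ₗ[K] N} (hc : IsCrossedHom ψ c) :
    ¬ Function.Bijective c := by
  intro hbij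
  obtain ⟨W, hW, hWb⟩ := exists_submodule_mem_iff_isNilpotent_toEnd (K := K) (H := N) N
  have hψ (D : LieDerivation K N N) (v : N) : D v ∈ W := (hW _).mpr (D.isNilpotent_ad_apply v)
  have hWtop : W ≠ ⊤ := by
    intro h
    refine hN ((isNilpotent_iff_forall (R := K)).mpr fun x ↦ (hW x).mp ?_)
    rw [h]
    trivial
  set S := derivedSeries K G 1
  set Z := center K G
  have hSW : S.toSubmodule.map c ≤ W := by
    have : S.toSubmodule = Submodule.span K {⁅x, y⁆ | (x : G) (y : G)} :=
      coe_derivedSeries_one_eq K G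
    rw [this, Submodule.map_span, Submodule.span_le]
    rintro _ ⟨_, ⟨x, y, rfl⟩, rfl⟩
    rw [hc x y]
    exact sub_mem (add_mem (hWb _ _) (hψ _ _)) (hψ _ _)
  have h1 := Submodule.finrank_sup_add_finrank_inf_eq S.toSubmodule Z.toSubmodule
  rw [derivedSeries_one_sup_center, finrank_top] at h1
  have h2 : Module.finrank K Z.toSubmodule = 1 := hG
  have h3 : Module.finrank K (S.toSubmodule.map c) = Module.finrank K S.toSubmodule :=
    (Submodule.equivMapOfInjective c hbij.1 S.toSubmodule).finrank_eq.symm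
  have h4 := Submodule.finrank_mono hSW
  have h5 := Submodule.finrank_lt hWtop
  have h6 : Module.finrank K G = Module.finrank K N :=
    (LinearEquiv.ofBijective c hbij).finrank_eq
  -- `dim S ≤ dim W ≤ dim G - 1`, whereas `dim S + 1 = dim G + dim (S ⊓ Z)`; so equality holds
  -- throughout.
  have hinf : S.toSubmodule ⊓ Z.toSubmodule = ⊥ := by
    rw [← Submodule.finrank_eq_zero]
    omega
  have hmap : S.toSubmodule.map c = W := Submodule.eq_of_le_of_finrank_le hSW (by omega)
  have : IsKilling K S := isKilling_derivedSeries_one hinf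
  let N' : LieSubalgebra K N := { W with lie_mem' := fun {x y} _ _ ↦ hWb x y }
  have : LieRing.IsNilpotent N' := by
    refine (isNilpotent_iff_forall (R := K)).mpr fun x ↦ ?_
    exact LieSubalgebra.isNilpotent_ad_of_isNilpotent_ad N' ((hW _).mp x.2)
  -- If `S = 0` then `W = 0`, so all brackets of `N` vanish, every element is ad-nilpotent and `W =
  -- ⊤`.
  have : Nontrivial S := by
    by_contra h
    rw [not_nontrivial_iff_subsingleton] at h
    have hW0 : W = ⊥ := by
      have : S.toSubmodule = ⊥ := (Submodule.subsingleton_iff_eq_bot).mp h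
      rw [← hmap, this, Submodule.map_bot]
    refine hWtop (eq_top_iff.mpr fun x _ ↦ (hW x).mpr ⟨1, LinearMap.ext fun y ↦ ?_⟩)
    have := hWb x y
    rw [hW0, Submodule.mem_bot] at this
    simpa using this
  let ψ' : S →ₗ⁅K⁆ LieDerivation K N' N' :=
    { toFun := fun x ↦
        { toLinearMap := (ψ x.1).toLinearMap.restrict (p := W) (q := W) fun v _ ↦ hψ _ v
          leibniz' := fun v w ↦ Subtype.ext ((ψ x.1).leibniz' v.1 w.1) }
      map_add' := fun x y ↦ LieDerivation.ext fun v ↦ Subtype.ext congr($(map_add ψ x.1 y.1) v.1)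
      map_smul' := fun t x ↦ LieDerivation.ext fun v ↦ Subtype.ext congr($(map_smul ψ t x.1) v.1)
      map_lie' := fun {x y} ↦ LieDerivation.ext fun v ↦ Subtype.ext congr($(LieHom.map_lie ψ x.1 y.1) v.1) }
  let c' : S →ₗ[K] N' := c.restrict (p := S.toSubmodule) (q := W) fun x hx ↦
    hSW ⟨x, hx, rfl⟩
  have hc' : IsCrossedHom ψ' c' := fun x y ↦ Subtype.ext (hc x.1 y.1)
  refine not_bijective_of_isCrossedHom ψ' hc' ⟨fun x y hxy ↦ ?_, fun w ↦ ?_⟩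
  · exact Subtype.ext (hbij.1 congr(($hxy : N)))
  · obtain ⟨x, hx, hxw⟩ := (hmap ▸ w.2 : w.1 ∈ S.toSubmodule.map c)
    exact ⟨⟨x, hx⟩, Subtype.ext hxw⟩

end LieAlgebra

theorem theorem5p1 {V : Type*} [AddCommGroup V] [Module ℂ V] [FiniteDimensional ℂ V]
    (g n : LieBracket ℂ V)
    (hg_reductive : LieAlgebra.HasCentralRadical ℂ g.Alg)
    (hg_center : Module.finrank ℂ (LieAlgebra.center ℂ g.Alg) = 1)
    (hn_solvable : LieAlgebra.IsSolvable n.Alg)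
    (hn_not_nilpotent : ¬ LieRing.IsNilpotent n.Alg) :
    IsEmpty (PostLieStructure g n) := by
  refine ⟨fun p ↦ ?_⟩
  have : FiniteDimensional ℂ g.Alg := inferInstanceAs (FiniteDimensional ℂ V)
  have : FiniteDimensional ℂ n.Alg := inferInstanceAs (FiniteDimensional ℂ V)
  let ψ : g.Alg →ₗ⁅ℂ⁆ LieDerivation ℂ n.Alg n.Alg :=
    { toFun := fun x ↦
        { toLinearMap := p.mul x
          leibniz' := fun y z ↦ by
            rw [← lie_skew z, sub_neg_eq_add, add_comm]
            exact p.mul_bracket x y z }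
      map_add' := fun x y ↦ LieDerivation.ext fun z ↦ p.mul.map_add₂ x y z
      map_smul' := fun t x ↦ LieDerivation.ext fun z ↦ p.mul.map_smul₂ t x z
      map_lie' := fun {x y} ↦ LieDerivation.ext fun z ↦ p.bracket_mul x y z }
  let c : g.Alg →ₗ[ℂ] n.Alg := (LinearMap.id : V →ₗ[ℂ] V)
  -- The first post-Lie axiom, rearranged.
  have hc : LieAlgebra.IsCrossedHom ψ c := by
    intro x y
    have h : g.toFun x y = n.toFun x y + p.mul x y - p.mul y x := by
      rw [add_sub_assoc, p.mul_sub_mul x y]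
      abel
    exact h
  exact LieAlgebra.not_bijective_of_isCrossedHom_of_hasCentralRadical hg_center
    hn_not_nilpotent ψ hc Function.bijective_id
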